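/- **Setting.** Let $G=(V,E)$ be an infinite, locally finite, connected graph with symmetric edge weights $\mu_{xy}\ge 0$, where $\mu_{xy}>0$ if and only if $x\sim y$, such that $\inf_{x\sim y}\mu_{xy}>0$. Let $m:V\to(0,\infty)$ be a vertex measure and put $m(B)=\sum_{x\in B}m(x)\in[0,\infty]$, $\deg(x)=\sum_{y}\mu_{xy}$ and $D_m=\sup_{x\in V}\deg(x)/m(x)$; assume $D_m<\infty$. Let $\Delta f(x)=\frac1{m(x)}\sum_{y}\mu_{xy}(f(y)-f(x))$, and let $\mu$ be the greatest lower bound of the spectrum of $-\Delta$ on $\ell^2(V,m)=\{f:V\to\mathbb R:\sum_x f(x)^2m(x)<\infty\}$. For finite $\Omega\subset V$ and $y\in\Omega$ let $p_t(\cdot,y,\Omega)$ be the function that vanishes outside $\Omega$, satisfies $\partial_t p_t(x,y,\Omega)=\Delta p_t(x,y,\Omega)$ for $x\in\Omega$, $t\ge0$ ($\Delta$ acting in $x$), and equals $\delta_y/m(y)$ at $t=0$; put $p_t(\cdot,y,\Omega)=0$ if $y\notin\Omega$. The minimal heat kernel is $p_t(x,y)=\lim_{i\to\infty}p_t(x,y,\Omega_i)$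 for any exhaustion $\Omega_1\subset\Omega_2\subset\cdots$ of $V$ by finite sets. Let $d(B_1,B_2)=\min_{x\in B_1,\,y\in B_2}d(x,y)$ be the combinatorial distance of two nonempty vertex sets (if $B_1$ or $B_2$ is empty, both sides of the estimates below are $0$, whatever value $d(B_1,B_2)$ is given). For $t>0$ and $d\ge0$ let $$\zeta(t,d)=d\,\operatorname{arcsinh}\!\left(\tfrac dt\right)-\sqrt{d^2+t^2}+t,$$ and let $\zeta(0,0)=0$, $\zeta(0,d)=\infty$ for $d>0$, with $e^{-\infty}=0$. **Theorem (Davies–Gaffney–Grigor'yan Lemma on graphs).** For every $0<\gamma<1$ there is a constant $\alpha=\alpha(\gamma)\ge1$, depending only on $\gamma$, such that for every $G$ and $m$ as above, all $B_1,B_2\subset V$ and all $t\ge0$, $$\sum_{x\in B_1}\sum_{y\in B_2}p_t(x,y)m(x)m(y)\le\sqrt{m(B_1)m(B_2)}\;e^{-(1-\gamma)\mu t}\exp\bigl(-\zeta(\alpha D_mt+1,\,d(B_1,B_2))\bigr).$$ Moreover (the case $\gamma=1$), for every $G$ and $m$ as above, all $B_1,B_2\subset V$ and all $t\ge0$, $$\sum_{x\in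 B_1}\sum_{y\in B_2}p_t(x,y)m(x)m(y)\le\sqrt{m(B_1)m(B_2)}\;\exp\bigl(-\tfrac12\zeta(D_mt,\,d(B_1,B_2))\bigr).$$ Both sides are in $[0,\infty]$, with $0\cdot\infty=0$. -/

import Mathlib

open scoped ENNReal Topology

universe u

/-- A locally finite connected weighted graph `(V, w)` with a positive vertex measure `m`.
Two vertices are neighbours exactly when `0 < w x y` (a loop `0 < w x x` is allowed). -/
structure WeightedGraph (V : Type u) where
  /-- the edge weights `μ_{xy}` -/
  w : V → V → ℝ
  w_symm : ∀ x y, w x y = w y x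
  w_nonneg : ∀ x y, 0 ≤ w x y
  locallyFinite : ∀ x, {y | 0 < w x y}.Finite
  /-- the infimum `μ_min` of the edge weights is positive -/
  exists_pos_le_w : ∃ δ > 0, ∀ x y, 0 < w x y → δ ≤ w x y
  /-- the vertex measure -/
  m : V → ℝ
  m_pos : ∀ x, 0 < m x
  connected : (SimpleGraph.fromRel fun x y => 0 < w x y).Connected

namespace WeightedGraph

variable {V : Type u} (G : WeightedGraph V)

/-- The underlying simple graph; it carries the combinatorial distance. -/
def graph : SimpleGraph V := SimpleGraph.fromRel fun x y => 0 < G.w x y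

/-- The neighbours of a vertex. -/
noncomputable def nbhd (x : V) : Finset V := (G.locallyFinite x).toFinset

/-- The weighted degree `deg x = ∑_y μ_{xy}`. -/
noncomputable def deg (x : V) : ℝ := ∑ y ∈ G.nbhd x, G.w x y

/-- `D_m < ∞`. -/
def BoundedDegree : Prop := BddAbove (Set.range fun x => G.deg x / G.m x)

/-- `D_m = sup_x deg x / m x`. -/
noncomputable def Dm : ℝ := ⨆ x, G.deg x / G.m x

/-- The Laplacian `Δ f x = (1 / m x) ∑_y μ_{xy} (f y - f x)`. -/
noncomputable def laplacian (f : V → ℝ) (x : V) : ℝ :=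
  (1 / G.m x) * ∑ y ∈ G.nbhd x, G.w x y * (f y - f x)

/-- `m(B) ∈ [0, ∞]`. -/
noncomputable def vol (B : Set V) : ℝ≥0∞ := ∑' x : B, ENNReal.ofReal (G.m x)

/-- The combinatorial distance `d(B₁, B₂)` of two sets of vertices
(with the value `0` if one of them is empty). -/
noncomputable def setDist (B₁ B₂ : Set V) : ℕ :=
  sInf {n | ∃ x ∈ B₁, ∃ y ∈ B₂, G.graph.dist x y = n}

/-! ### The `ℓ²`-spectrum -/

/-- `f ∈ ℓ²(V, m)`. -/
def MemL2 (f : V → ℝ) : Prop := Summable fun x => f x ^ 2 * G.m x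

/-- The norm of `ℓ²(V, m)`. -/
noncomputable def l2norm (f : V → ℝ) : ℝ := √(∑' x, f x ^ 2 * G.m x)

/-- The domain of the Laplacian in `ℓ²(V, m)`. It is all of `ℓ²(V, m)` if `D_m < ∞`,
and then `Δ` is a bounded self-adjoint operator. -/
def MemDomain (f : V → ℝ) : Prop := G.MemL2 f ∧ G.MemL2 (G.laplacian f)

/-- The resolvent set of `-Δ` in `ℓ²(V, m)`: the `z` for which `-Δ - z` is a bijection from
the domain onto `ℓ²(V, m)` with bounded inverse. -/
def l2ResolventSet : Set ℝ :=
  {z | (∀ g, G.MemL2 g → ∃! f, G.MemDomain f ∧ -G.laplacian f - z • f = g) ∧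
    ∃ C : ℝ, ∀ f, G.MemDomain f → G.l2norm f ≤ C * G.l2norm (-G.laplacian f - z • f)}

/-- The `ℓ²`-spectrum of `-Δ`. -/
def l2Spectrum : Set ℝ := G.l2ResolventSetᶜ

/-- The greatest lower bound `μ` of the `ℓ²`-spectrum of `-Δ`. -/
noncomputable def spectralBottom : ℝ := sInf G.l2Spectrum

/-! ### The heat kernel -/

open scoped Classical in
/-- The matrix of the Dirichlet Laplacian of a finite set `Ω`, that is, of the operator
`f ↦ (Δ f)|_Ω` on the functions which vanish outside `Ω`. -/
noncomputable def dirichletLaplacian (Ω : Finset V) : Matrix Ω Ω ℝ :=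
  Matrix.of fun x y => G.laplacian (Pi.single (y : V) 1) x

open scoped Classical in
/-- The Dirichlet heat kernel `p_t(x, y, Ω)`: for fixed `y ∈ Ω`, the solution of the Dirichlet heat
equation on `Ω` with initial value `δ_y / m y`. -/
noncomputable def dirichletHeatKernel (Ω : Finset V) (t : ℝ) (x y : V) : ℝ :=
  if h : x ∈ Ω ∧ y ∈ Ω then
    NormedSpace.exp (t • G.dirichletLaplacian Ω) ⟨x, h.1⟩ ⟨y, h.2⟩ / G.m y
  else 0

/-- The minimal heat kernel: the limit of the Dirichlet heat kernels along the finite subsets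
of `V`. -/
noncomputable def minimalHeatKernel (t : ℝ) (x y : V) : ℝ :=
  Filter.limUnder Filter.atTop fun Ω : Finset V => G.dirichletHeatKernel Ω t x y

/-! ### The two definitions describe what they should -/

theorem sum_nbhd_eq (x : V) (S : Finset V) (hS : G.nbhd x ⊆ S) (g : V → ℝ) :
    ∑ y ∈ G.nbhd x, G.w x y * g y = ∑ y ∈ S, G.w x y * g y := by
  refine Finset.sum_subset hS fun y _ hy => ?_
  have : G.w x y = 0 := by
    refine le_antisymm (not_lt.1 fun h => hy ?_) (G.w_nonneg x y)
    simpa [nbhd] using h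
  simp [this]

theorem deg_eq (x : V) (S : Finset V) (hS : G.nbhd x ⊆ S) : G.deg x = ∑ y ∈ S, G.w x y := by
  simpa [deg] using G.sum_nbhd_eq x S hS 1

theorem sum_w_le_deg (x : V) (S : Finset V) : ∑ y ∈ S, G.w x y ≤ G.deg x := by
  classical
  rw [G.deg_eq x (G.nbhd x ∪ S) Finset.subset_union_left]
  exact Finset.sum_le_sum_of_subset_of_nonneg Finset.subset_union_right
    fun y _ _ => G.w_nonneg x y

/-- `Δ f x = (∑_{y ∈ Ω} μ_{xy} f y - deg x f x) / m x` for `f` supported in `Ω`. -/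
theorem laplacian_eq (f : V → ℝ) (Ω : Finset V) (hf : ∀ y, y ∉ Ω → f y = 0) (x : V) :
    G.laplacian f x = (∑ y ∈ Ω, G.w x y * f y - G.deg x * f x) / G.m x := by
  classical
  have h : ∑ y ∈ Ω, G.w x y * f y = ∑ y ∈ G.nbhd x ∪ Ω, G.w x y * f y :=
    Finset.sum_subset Finset.subset_union_right fun y _ hy => by simp [hf y hy]
  rw [laplacian, h, G.deg_eq x _ (Finset.subset_union_left (s₂ := Ω)),
    G.sum_nbhd_eq x _ (Finset.subset_union_left (s₂ := Ω)) (fun y => f y - f x),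
    Finset.sum_mul, ← Finset.sum_sub_distrib]
  simp_rw [mul_sub]
  ring

open scoped Classical in
theorem dirichletLaplacian_apply (Ω : Finset V) (x y : Ω) :
    G.dirichletLaplacian Ω x y = (G.w x y - if x = y then G.deg x else 0) / G.m x := by
  rw [dirichletLaplacian, Matrix.of_apply, G.laplacian_eq _ Ω]
  · congr 2
    · simp [Pi.single_apply]
    · by_cases h : x = y
      · simp [h]
      · have h' : (x : V) ≠ y := fun e => h (Subtype.ext e)
        simp [h, h']
  · intro z hz
    have : z ≠ y := fun h => hz (h ▸ y.2)
    simp [this]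

open scoped Classical in
/-- `p_t(·, y, Ω)` vanishes outside `Ω`. -/
theorem dirichletHeatKernel_of_notMem (Ω : Finset V) (t : ℝ) (x y : V) (hx : x ∉ Ω) :
    G.dirichletHeatKernel Ω t x y = 0 := by
  simp [dirichletHeatKernel, hx]

open scoped Classical in
/-- `p_0(·, y, Ω) = δ_y / m y`. -/
theorem dirichletHeatKernel_zero (Ω : Finset V) (x y : V) (hy : y ∈ Ω) :
    G.dirichletHeatKernel Ω 0 x y = (Pi.single y 1 : V → ℝ) x / G.m y := by
  by_cases hx : x ∈ Ω
  · simp [dirichletHeatKernel, hx, hy, Matrix.one_apply, Pi.single_apply]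
  · have : x ≠ y := fun h => hx (h ▸ hy)
    simp [dirichletHeatKernel, hx, this]

open scoped Classical in
theorem dirichletHeatKernel_coe (Ω : Finset V) (t : ℝ) (x y : Ω) :
    G.dirichletHeatKernel Ω t x y = NormedSpace.exp (t • G.dirichletLaplacian Ω) x y / G.m y := by
  simp [dirichletHeatKernel]

open scoped Classical Matrix.Norms.Operator in
theorem hasDerivAt_exp_dirichletLaplacian (Ω : Finset V) (t : ℝ) (x y : Ω) :
    HasDerivAt (fun s : ℝ => NormedSpace.exp (s • G.dirichletLaplacian Ω) x y)
      (∑ z, G.dirichletLaplacian Ω x z * NormedSpace.exp (t • G.dirichletLaplacian Ω) z y) t :=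
  hasDerivAt_pi.1
    (hasDerivAt_pi.1 (hasDerivAt_exp_smul_const' (𝕂 := ℝ) (G.dirichletLaplacian Ω) t) x) y

/-- `p_t(·, y, Ω)` solves the heat equation in `Ω`. -/
theorem hasDerivAt_dirichletHeatKernel (Ω : Finset V) (t : ℝ) (x y : V) (hx : x ∈ Ω) :
    HasDerivAt (fun s => G.dirichletHeatKernel Ω s x y)
      (G.laplacian (fun z => G.dirichletHeatKernel Ω t z y) x) t := by
  classical
  by_cases hy : y ∈ Ω
  · lift x to Ω using hx
    lift y to Ω using hy
    rw [G.laplacian_eq _ Ω (fun z hz => G.dirichletHeatKernel_of_notMem Ω t z y hz),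
      ← Finset.sum_coe_sort]
    simp only [dirichletHeatKernel_coe]
    refine ((G.hasDerivAt_exp_dirichletLaplacian Ω t x y).div_const (G.m y)).congr_deriv ?_
    simp only [dirichletLaplacian_apply, Finset.sum_div, sub_mul, sub_div,
      Finset.sum_sub_distrib, ite_mul, ite_div, zero_mul, zero_div, Finset.sum_ite_eq,
      Finset.mem_univ, if_true]
    congr 1
    · refine Finset.sum_congr rfl fun z _ => ?_
      ring
    · ring
  · have e : (fun s => G.dirichletHeatKernel Ω s x y) = fun _ => 0 := by
      ext s; simp [dirichletHeatKernel, hy]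
    have e' : G.laplacian (fun z => G.dirichletHeatKernel Ω t z y) x = 0 := by
      simp [laplacian, dirichletHeatKernel, hy]
    rw [e, e']
    exact hasDerivAt_const _ _

open scoped Classical in
/-- The Dirichlet Laplacian, shifted so that its entries are nonnegative. -/
noncomputable def shifted (Ω : Finset V) (c : ℝ) : Matrix Ω Ω ℝ :=
  G.dirichletLaplacian Ω + c • (1 : Matrix Ω Ω ℝ)

open scoped Classical in
theorem shifted_apply (Ω : Finset V) (c : ℝ) (x y : Ω) :
    G.shifted Ω c x y = G.w x y / G.m x + if x = y then c - G.deg x / G.m x else 0 := by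
  rw [shifted, Matrix.add_apply, Matrix.smul_apply, dirichletLaplacian_apply, Matrix.one_apply]
  split_ifs
  · simp
    ring
  · simp

theorem shifted_nonneg (Ω : Finset V) (c : ℝ) (hc : ∀ x ∈ Ω, G.deg x / G.m x ≤ c) (x y : Ω) :
    0 ≤ G.shifted Ω c x y := by
  classical
  rw [shifted_apply]
  have h1 := div_nonneg (G.w_nonneg x y) (G.m_pos x).le
  have h2 := hc x x.2
  split_ifs <;> linarith

open scoped Classical in
theorem shifted_pow_nonneg (Ω : Finset V) (c : ℝ) (hc : ∀ x ∈ Ω, G.deg x / G.m x ≤ c) (k : ℕ)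
    (x y : Ω) : 0 ≤ (G.shifted Ω c ^ k) x y := by
  induction k generalizing x y with
  | zero => rw [pow_zero, Matrix.one_apply]; split_ifs <;> norm_num
  | succ k ih =>
    rw [pow_succ', Matrix.mul_apply]
    exact Finset.sum_nonneg fun z _ => mul_nonneg (G.shifted_nonneg Ω c hc x z) (ih z y)

open scoped Classical in
theorem shifted_pow_mono (Ω Ω' : Finset V) (h : Ω ⊆ Ω') (c : ℝ)
    (hc : ∀ x ∈ Ω', G.deg x / G.m x ≤ c) (k : ℕ) (x y : Ω) :
    (G.shifted Ω c ^ k) x y ≤ (G.shifted Ω' c ^ k) ⟨x, h x.2⟩ ⟨y, h y.2⟩ := by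
  induction k generalizing x y with
  | zero =>
    by_cases h : x = y
    · simp [h]
    · have h' : (x : V) ≠ y := fun e => h (Subtype.ext e)
      simp [h, h']
  | succ k ih =>
    rw [pow_succ', pow_succ', Matrix.mul_apply, Matrix.mul_apply]
    let i : Ω ↪ Ω' := ⟨fun z => ⟨z, h z.2⟩, fun a b hab =>
      Subtype.ext (Subtype.mk.inj hab)⟩
    calc ∑ z, G.shifted Ω c x z * (G.shifted Ω c ^ k) z y
        ≤ ∑ z, G.shifted Ω' c (i x) (i z) * (G.shifted Ω' c ^ k) (i z) (i y) := by
          refine Finset.sum_le_sum fun z _ => ?_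
          have e : G.shifted Ω c x z = G.shifted Ω' c (i x) (i z) := by
            rw [shifted_apply, shifted_apply]
            congr 2
            exact propext i.injective.eq_iff.symm
          rw [e]
          exact mul_le_mul_of_nonneg_left (ih z y) (G.shifted_nonneg Ω' c hc _ _)
      _ = ∑ z ∈ Finset.univ.map i, G.shifted Ω' c (i x) z * (G.shifted Ω' c ^ k) z (i y) := by
          rw [Finset.sum_map]
      _ ≤ ∑ z, G.shifted Ω' c (i x) z * (G.shifted Ω' c ^ k) z (i y) :=
          Finset.sum_le_sum_of_subset_of_nonneg (Finset.subset_univ _) fun z _ _ =>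
            mul_nonneg (G.shifted_nonneg Ω' c hc _ _) (G.shifted_pow_nonneg Ω' c hc k _ _)

open scoped Classical in
theorem shifted_pow_le (Ω : Finset V) (c : ℝ) (hc : ∀ x ∈ Ω, G.deg x / G.m x ≤ c) (hc0 : 0 ≤ c)
    (k : ℕ) (x y : Ω) : (G.shifted Ω c ^ k) x y ≤ c ^ k := by
  induction k generalizing x y with
  | zero => rw [pow_zero, pow_zero, Matrix.one_apply]; split_ifs <;> norm_num
  | succ k ih =>
    rw [pow_succ', pow_succ', Matrix.mul_apply]
    calc ∑ z, G.shifted Ω c x z * (G.shifted Ω c ^ k) z y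
        ≤ ∑ z, G.shifted Ω c x z * c ^ k := Finset.sum_le_sum fun z _ =>
          mul_le_mul_of_nonneg_left (ih z y) (G.shifted_nonneg Ω c hc x z)
      _ = (∑ z, G.shifted Ω c x z) * c ^ k := by rw [Finset.sum_mul]
      _ ≤ c * c ^ k := by
          refine mul_le_mul_of_nonneg_right ?_ (pow_nonneg hc0 k)
          simp only [shifted_apply, Finset.sum_add_distrib, Finset.sum_ite_eq, Finset.mem_univ,
            if_true, ← Finset.sum_div]
          have h1 : ∑ z : Ω, G.w x z ≤ G.deg x := by
            rw [Finset.sum_coe_sort Ω fun z => G.w x z]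
            exact G.sum_w_le_deg x Ω
          have := div_le_div_of_nonneg_right h1 (G.m_pos x).le
          linarith

open scoped Classical Matrix.Norms.Operator in
theorem hasSum_exp_dirichletLaplacian (Ω : Finset V) (c t : ℝ) (x y : Ω) :
    HasSum (fun k : ℕ => Real.exp (-(t * c)) * ((k.factorial : ℝ)⁻¹ * (t ^ k *
      (G.shifted Ω c ^ k) x y))) (NormedSpace.exp (t • G.dirichletLaplacian Ω) x y) := by
  have h := NormedSpace.exp_series_hasSum_exp' (𝕂 := ℝ) (t • G.shifted Ω c)
  have h1 := (Pi.hasSum.1 ((Pi.hasSum.1 h) x)) y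
  have e : NormedSpace.exp (t • G.dirichletLaplacian Ω)
      = Real.exp (-(t * c)) • NormedSpace.exp (t • G.shifted Ω c) := by
    have e1 : t • G.dirichletLaplacian Ω
        = algebraMap ℝ (Matrix Ω Ω ℝ) (-(t * c)) + t • G.shifted Ω c := by
      rw [shifted, Algebra.algebraMap_eq_smul_one, smul_add, smul_smul, neg_smul]
      abel
    have e3 : NormedSpace.exp (algebraMap ℝ (Matrix Ω Ω ℝ) (-(t * c)))
        = algebraMap ℝ (Matrix Ω Ω ℝ) (Real.exp (-(t * c))) := by
      rw [Real.exp_eq_exp_ℝ]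
      exact (NormedSpace.algebraMap_exp_comm _).symm
    rw [e1, Matrix.exp_add_of_commute _ _ (Algebra.commute_algebraMap_left _ _), e3]
    exact (Algebra.smul_def _ _).symm
  rw [e, Matrix.smul_apply, smul_eq_mul]
  refine HasSum.mul_left _ ?_
  have e2 : (fun k : ℕ => (k.factorial : ℝ)⁻¹ * (t ^ k * (G.shifted Ω c ^ k) x y))
      = fun k : ℕ => ((k.factorial : ℝ)⁻¹ • (t • G.shifted Ω c) ^ k) x y := by
    ext k
    rw [smul_pow, Matrix.smul_apply, Matrix.smul_apply, smul_eq_mul, smul_eq_mul]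
  rw [e2]
  exact h1

theorem exists_deg_div_le (Ω : Finset V) : ∃ c, 0 ≤ c ∧ ∀ x ∈ Ω, G.deg x / G.m x ≤ c := by
  obtain ⟨c, hc⟩ := (Ω.image fun x => G.deg x / G.m x).bddAbove
  exact ⟨max c 0, le_max_right _ _, fun x hx =>
    (hc (Finset.mem_coe.2 (Finset.mem_image_of_mem _ hx))).trans (le_max_left _ _)⟩

theorem dirichletHeatKernel_nonneg (Ω : Finset V) (t : ℝ) (ht : 0 ≤ t) (x y : V) :
    0 ≤ G.dirichletHeatKernel Ω t x y := by
  classical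
  obtain ⟨c, -, hc⟩ := G.exists_deg_div_le Ω
  by_cases h : x ∈ Ω ∧ y ∈ Ω
  · rw [dirichletHeatKernel, dif_pos h]
    refine div_nonneg ?_ (G.m_pos y).le
    refine (G.hasSum_exp_dirichletLaplacian Ω c t ⟨x, h.1⟩ ⟨y, h.2⟩).nonneg fun k => ?_
    have := G.shifted_pow_nonneg Ω c hc k ⟨x, h.1⟩ ⟨y, h.2⟩
    positivity
  · rw [dirichletHeatKernel, dif_neg h]

theorem dirichletHeatKernel_mono (t : ℝ) (ht : 0 ≤ t) (x y : V) :
    Monotone fun Ω => G.dirichletHeatKernel Ω t x y := by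
  classical
  intro Ω Ω' hΩ
  obtain ⟨c, -, hc⟩ := G.exists_deg_div_le Ω'
  by_cases h : x ∈ Ω ∧ y ∈ Ω
  · have h' : x ∈ Ω' ∧ y ∈ Ω' := ⟨hΩ h.1, hΩ h.2⟩
    simp only [dirichletHeatKernel, dif_pos h, dif_pos h']
    refine div_le_div_of_nonneg_right ?_ (G.m_pos y).le
    refine hasSum_le (fun k => ?_) (G.hasSum_exp_dirichletLaplacian Ω c t ⟨x, h.1⟩ ⟨y, h.2⟩)
      (G.hasSum_exp_dirichletLaplacian Ω' c t ⟨x, h'.1⟩ ⟨y, h'.2⟩)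
    have := G.shifted_pow_mono Ω Ω' hΩ c hc k ⟨x, h.1⟩ ⟨y, h.2⟩
    gcongr
  · have := G.dirichletHeatKernel_nonneg Ω' t ht x y
    simpa only [dirichletHeatKernel, dif_neg h] using this

theorem dirichletHeatKernel_le (Ω : Finset V) (t : ℝ) (ht : 0 ≤ t) (x y : V) :
    G.dirichletHeatKernel Ω t x y ≤ 1 / G.m y := by
  classical
  obtain ⟨c, hc0, hc⟩ := G.exists_deg_div_le Ω
  by_cases h : x ∈ Ω ∧ y ∈ Ω
  · rw [dirichletHeatKernel, dif_pos h]
    refine div_le_div_of_nonneg_right ?_ (G.m_pos y).le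
    have hs : HasSum (fun k : ℕ => Real.exp (-(t * c)) * ((k.factorial : ℝ)⁻¹ * (t ^ k * c ^ k)))
        1 := by
      have h1 := (NormedSpace.exp_series_hasSum_exp' (𝕂 := ℝ) (t * c)).mul_left
        (Real.exp (-(t * c)))
      rw [← Real.exp_eq_exp_ℝ, ← Real.exp_add] at h1
      simpa [mul_pow] using h1
    refine hasSum_le (fun k => ?_) (G.hasSum_exp_dirichletLaplacian Ω c t ⟨x, h.1⟩ ⟨y, h.2⟩) hs
    have := G.shifted_pow_le Ω c hc hc0 k ⟨x, h.1⟩ ⟨y, h.2⟩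
    gcongr
  · rw [dirichletHeatKernel, dif_neg h]
    exact (one_div_pos.2 (G.m_pos y)).le

/-- The limit which defines the minimal heat kernel exists. -/
theorem tendsto_minimalHeatKernel (t : ℝ) (ht : 0 ≤ t) (x y : V) :
    Filter.Tendsto (fun Ω => G.dirichletHeatKernel Ω t x y) Filter.atTop
      (𝓝 (G.minimalHeatKernel t x y)) := by
  refine tendsto_nhds_limUnder ⟨_, tendsto_atTop_ciSup (G.dirichletHeatKernel_mono t ht x y)
    ⟨1 / G.m y, ?_⟩⟩
  rintro _ ⟨Ω, rfl⟩
  exact G.dirichletHeatKernel_le Ω t ht x y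

/-- The minimal heat kernel is the limit of the Dirichlet heat kernels along every exhaustion of
`V` by finite sets. -/
theorem tendsto_minimalHeatKernel_of_exhaustion (Ω : ℕ → Finset V) (hmono : Monotone Ω)
    (hcover : ∀ x, ∃ i, x ∈ Ω i) (t : ℝ) (ht : 0 ≤ t) (x y : V) :
    Filter.Tendsto (fun i => G.dirichletHeatKernel (Ω i) t x y) Filter.atTop
      (𝓝 (G.minimalHeatKernel t x y)) :=
  (G.tendsto_minimalHeatKernel t ht x y).comp (hmono.tendsto_atTop_finset hcover)

end WeightedGraph

/-- `ζ(t, d) = d arcsinh (d / t) - √(d² + t²) + t` for `t > 0`, `d ≥ 0`, extended continuously by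
`ζ(0, 0) = 0` and `ζ(0, d) = ∞` for `d > 0`. -/
noncomputable def zeta (t d : ℝ) : EReal :=
  if t = 0 ∧ 0 < d then ⊤
  else ((d * Real.arsinh (d / t) - √(d ^ 2 + t ^ 2) + t : ℝ) : EReal)

namespace WeightedGraph

variable {V : Type u} (G : WeightedGraph V)

/-! The argument is Davies' exponential perturbation method. Let `u` be the Dirichlet heat flow on a
finite set started from the indicator of `S ⊆ B₂`, and let `ψ = κ d(·, B₂)`. Conjugating the form of
`-Δ` by `e^ψ` and symmetrizing turns each edge weight `w` into `w cosh (ψ x - ψ y)`. As `ψ` varies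
by at most `κ` along edges, Schur's test bounds the perturbation by `D_m (cosh κ - 1) ‖e^ψ u‖²`. If
`c` is a lower bound of the unperturbed form, `‖e^ψ u‖²` grows at rate at most `2 (D_m (cosh κ - 1)
- c)`. Cauchy–Schwarz on `B₁`, where `ψ ≥ κ d(B₁, B₂)`, gives the exponent `(D_m (cosh κ - 1) - c) t
- κ d` (`BoundedDegree.sum_minimalHeatKernel_le_exp_setDist`).

Two facts complete the proof. The spectral bottom is an admissible `c`
(`BoundedDegree.spectralBottom_mem`), since the best form bound lies in the spectrum. And `ζ(s, d)`
is the value of `κ d - s (cosh κ - 1)` at its critical point `sinh κ = d / s` (`zeta_eq_sub_cosh`).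
The constant `α = 1` suffices for every `γ`. -/

theorem deg_nonneg (x : V) : 0 ≤ G.deg x :=
  Finset.sum_nonneg fun y _ => G.w_nonneg x y

theorem Dm_nonneg : 0 ≤ G.Dm :=
  Real.iSup_nonneg fun x => div_nonneg (G.deg_nonneg x) (G.m_pos x).le

variable {G} in
theorem BoundedDegree.deg_le (hG : G.BoundedDegree) (x : V) : G.deg x ≤ G.Dm * G.m x :=
  (div_le_iff₀ (G.m_pos x)).1 (le_ciSup hG x)

/-! ### The quadratic form of the Laplacian on finitely supported functions -/

/-- The squared `ℓ²`-norm of a function supported in `Ω`. -/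
noncomputable def sqNorm (Ω : Finset V) (f : V → ℝ) : ℝ := ∑ x ∈ Ω, f x ^ 2 * G.m x

/-- The bilinear form `(-Δ f, g)` of functions supported in `Ω`. -/
noncomputable def form (Ω : Finset V) (f g : V → ℝ) : ℝ :=
  ∑ x ∈ Ω, G.deg x * (f x * g x) - ∑ x ∈ Ω, ∑ y ∈ Ω, G.w x y * (f x * g y)

theorem sqNorm_nonneg (Ω : Finset V) (f : V → ℝ) : 0 ≤ G.sqNorm Ω f :=
  Finset.sum_nonneg fun x _ => mul_nonneg (sq_nonneg _) (G.m_pos x).le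

theorem sum_mul_laplacian (Ω : Finset V) (f g : V → ℝ) (hg : ∀ x, x ∉ Ω → g x = 0) :
    ∑ x ∈ Ω, f x * G.laplacian g x * G.m x = -G.form Ω f g := by
  rw [form, neg_sub, ← Finset.sum_sub_distrib]
  refine Finset.sum_congr rfl fun x _ => ?_
  rw [G.laplacian_eq g Ω hg, mul_assoc, div_mul_cancel₀ _ (G.m_pos x).ne', mul_sub,
    Finset.mul_sum]
  congr 1
  · exact Finset.sum_congr rfl fun y _ => by ring
  · ring

theorem sum_sum_w_comm (Ω : Finset V) (k : V → V → ℝ) :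
    ∑ x ∈ Ω, ∑ y ∈ Ω, G.w x y * k x y = ∑ x ∈ Ω, ∑ y ∈ Ω, G.w x y * k y x := by
  rw [Finset.sum_comm]
  exact Finset.sum_congr rfl fun y _ => Finset.sum_congr rfl fun x _ => by rw [G.w_symm]

theorem form_comm (Ω : Finset V) (f g : V → ℝ) : G.form Ω f g = G.form Ω g f := by
  rw [form, form, G.sum_sum_w_comm]
  simp only [mul_comm (f _) (g _)]

/-- Schur's test. -/
theorem sum_sum_w_abs_le (Ω : Finset V) (f : V → ℝ) :
    ∑ x ∈ Ω, ∑ y ∈ Ω, G.w x y * (|f x| * |f y|) ≤ ∑ x ∈ Ω, G.deg x * (f x * f x) := by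
  have h1 : ∑ x ∈ Ω, ∑ y ∈ Ω, G.w x y * (f x * f x) ≤ ∑ x ∈ Ω, G.deg x * (f x * f x) := by
    refine Finset.sum_le_sum fun x _ => ?_
    rw [← Finset.sum_mul]
    exact mul_le_mul_of_nonneg_right (G.sum_w_le_deg x Ω) (mul_self_nonneg _)
  have h2 := G.sum_sum_w_comm Ω fun x _ => f x * f x
  -- `2ab ≤ a² + b²` on each edge; by symmetry of the weights both squares contribute the same sum.
  have h3 : ∑ x ∈ Ω, ∑ y ∈ Ω, 2 * (G.w x y * (|f x| * |f y|)) ≤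
      ∑ x ∈ Ω, ∑ y ∈ Ω, (G.w x y * (f x * f x) + G.w x y * (f y * f y)) := by
    refine Finset.sum_le_sum fun x _ => Finset.sum_le_sum fun y _ => ?_
    rw [← abs_mul_abs_self (f x), ← abs_mul_abs_self (f y)]
    nlinarith [mul_nonneg (G.w_nonneg x y) (sq_nonneg (|f x| - |f y|))]
  simp only [← Finset.mul_sum, Finset.sum_add_distrib] at h3
  linarith

theorem abs_sum_sum_w_le (Ω : Finset V) (f : V → ℝ) :
    |∑ x ∈ Ω, ∑ y ∈ Ω, G.w x y * (f x * f y)| ≤ ∑ x ∈ Ω, G.deg x * (f x * f x) := by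
  refine ((Finset.abs_sum_le_sum_abs _ _).trans (Finset.sum_le_sum fun x _ =>
    Finset.abs_sum_le_sum_abs _ _)).trans (le_of_eq_of_le ?_ (G.sum_sum_w_abs_le Ω f))
  simp only [abs_mul, abs_of_nonneg (G.w_nonneg _ _)]

theorem form_self_nonneg (Ω : Finset V) (f : V → ℝ) : 0 ≤ G.form Ω f f :=
  sub_nonneg.2 ((le_abs_self _).trans (G.abs_sum_sum_w_le Ω f))

variable {G}

theorem BoundedDegree.sum_deg_le (hG : G.BoundedDegree) (Ω : Finset V) (f : V → ℝ) :
    ∑ x ∈ Ω, G.deg x * (f x * f x) ≤ G.Dm * G.sqNorm Ω f := by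
  rw [sqNorm, Finset.mul_sum]
  refine Finset.sum_le_sum fun x _ => ?_
  nlinarith [mul_le_mul_of_nonneg_right (hG.deg_le x) (mul_self_nonneg (f x))]

theorem BoundedDegree.form_self_le (hG : G.BoundedDegree) (Ω : Finset V) (f : V → ℝ) :
    G.form Ω f f ≤ 2 * G.Dm * G.sqNorm Ω f := by
  have h1 := hG.sum_deg_le Ω f
  have h2 := (abs_le.1 (G.abs_sum_sum_w_le Ω f)).1
  rw [form]
  linarith

variable (G)

theorem form_sub_smul (Ω : Finset V) (f h : V → ℝ) (s : ℝ) :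
    G.form Ω (f - s • h) (f - s • h) =
      G.form Ω f f - 2 * s * G.form Ω h f + s ^ 2 * G.form Ω h h := by
  have e : G.form Ω (f - s • h) (f - s • h) =
      G.form Ω f f - s * G.form Ω h f - s * G.form Ω f h + s ^ 2 * G.form Ω h h := by
    simp only [form, mul_sub, Finset.mul_sum, ← Finset.sum_sub_distrib, ← Finset.sum_add_distrib,
      Pi.sub_apply, Pi.smul_apply, smul_eq_mul]
    refine Finset.sum_congr rfl fun x _ => ?_
    rw [show ∀ a b c d e f g h : ℝ, a - e - (b - f) - (c - g) + (d - h) =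
      (a - b - c + d) - (e - f - g + h) by intros; ring, ← Finset.sum_sub_distrib,
      ← Finset.sum_sub_distrib, ← Finset.sum_add_distrib]
    congr 1
    · ring
    · exact Finset.sum_congr rfl fun y _ => by ring
  rw [e, G.form_comm Ω f h]
  ring

theorem sqNorm_sub_smul (Ω : Finset V) (f h : V → ℝ) (s : ℝ) :
    G.sqNorm Ω (f - s • h) =
      G.sqNorm Ω f - 2 * s * ∑ x ∈ Ω, h x * f x * G.m x + s ^ 2 * G.sqNorm Ω h := by
  simp only [sqNorm, Finset.mul_sum, ← Finset.sum_sub_distrib, ← Finset.sum_add_distrib,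
    Pi.sub_apply, Pi.smul_apply, smul_eq_mul]
  exact Finset.sum_congr rfl fun x _ => by ring

/-- The Laplacian has range one, so finitely supported functions lie in its domain and their
resolvent estimates reduce to finite sums. -/
theorem laplacian_eq_zero {f : V → ℝ} {Ω Ω' : Finset V} (hf : ∀ x, x ∉ Ω → f x = 0)
    (hsub : Ω ⊆ Ω') (hn : ∀ x ∈ Ω, G.nbhd x ⊆ Ω') {x : V} (hx : x ∉ Ω') :
    G.laplacian f x = 0 := by
  rw [G.laplacian_eq f Ω hf, hf x fun h => hx (hsub h), mul_zero, sub_zero,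
    Finset.sum_eq_zero, zero_div]
  intro y hy
  have : G.w x y = 0 := by
    refine le_antisymm (not_lt.1 fun h => hx (hn y hy ?_)) (G.w_nonneg x y)
    rw [G.w_symm] at h
    simpa [nbhd] using h
  simp [this]

theorem memL2_of_support {f : V → ℝ} {Ω : Finset V} (hf : ∀ x, x ∉ Ω → f x = 0) :
    G.MemL2 f :=
  summable_of_ne_finset_zero (s := Ω) fun x hx => by simp [hf x hx]

theorem l2norm_sq_of_support {f : V → ℝ} {Ω : Finset V} (hf : ∀ x, x ∉ Ω → f x = 0) :
    G.l2norm f ^ 2 = G.sqNorm Ω f := by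
  rw [l2norm, tsum_eq_sum (s := Ω) fun x hx => by simp [hf x hx]]
  exact Real.sq_sqrt (G.sqNorm_nonneg Ω f)

theorem sqNorm_eq_of_subset {f : V → ℝ} {Ω Ω' : Finset V} (hf : ∀ x, x ∉ Ω → f x = 0)
    (h : Ω ⊆ Ω') : G.sqNorm Ω' f = G.sqNorm Ω f :=
  (Finset.sum_subset h fun x _ hx => by simp [hf x hx]).symm

/-- Both sides are `-∑ f Δf m`, and points where `f` vanishes add nothing. -/
theorem form_eq_of_subset {f : V → ℝ} {Ω Ω' : Finset V} (hf : ∀ x, x ∉ Ω → f x = 0)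
    (h : Ω ⊆ Ω') : G.form Ω' f f = G.form Ω f f := by
  rw [← neg_neg (G.form Ω' f f), ← neg_neg (G.form Ω f f), ← G.sum_mul_laplacian Ω f f hf,
    ← G.sum_mul_laplacian Ω' f f fun x hx => hf x fun hx' => hx (h hx')]
  exact congrArg _ (Finset.sum_subset h fun x _ hx => by simp [hf x hx]).symm

/-! ### Form bounds and the bottom of the spectrum -/

/-- The lower bounds of the quadratic form of `-Δ` on finitely supported functions. -/
def formLowerBounds : Set ℝ :=
  {c | ∀ (Ω : Finset V) (f : V → ℝ), (∀ x, x ∉ Ω → f x = 0) → c * G.sqNorm Ω f ≤ G.form Ω f f}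

theorem zero_mem_formLowerBounds : 0 ∈ G.formLowerBounds := fun Ω f _ => by
  simpa using G.form_self_nonneg Ω f

variable {G} in
theorem mem_formLowerBounds_of_le {a b : ℝ} (hb : b ∈ G.formLowerBounds) (h : a ≤ b) :
    a ∈ G.formLowerBounds := fun Ω f hf =>
  (mul_le_mul_of_nonneg_right h (G.sqNorm_nonneg Ω f)).trans (hb Ω f hf)

theorem bddAbove_formLowerBounds [Nonempty V] : BddAbove G.formLowerBounds := by
  classical
  obtain ⟨x⟩ := ‹Nonempty V›
  refine ⟨(G.deg x - G.w x x) / G.m x, fun c hc => (le_div_iff₀ (G.m_pos x)).2 ?_⟩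
  have := hc {x} (Pi.single x 1) fun y hy => by
    rw [Finset.mem_singleton] at hy
    simp [hy]
  simpa [sqNorm, form] using this

theorem csSup_mem_formLowerBounds [Nonempty V] :
    sSup G.formLowerBounds ∈ G.formLowerBounds := by
  intro Ω f hf
  rcases (G.sqNorm_nonneg Ω f).eq_or_lt with h | h
  · rw [← h, mul_zero]
    exact G.form_self_nonneg Ω f
  · rw [← le_div_iff₀ h]
    exact csSup_le ⟨0, G.zero_mem_formLowerBounds⟩ fun c hc => (le_div_iff₀ h).2 (hc Ω f hf)

variable {G}

/-- If `c` bounds the form of `-Δ` from below, then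
`‖(-Δ - c) f‖² ≤ K ((-Δ - c) f, f)` for finitely supported `f`. -/
theorem BoundedDegree.sqNorm_le_of_mem (hG : G.BoundedDegree) {c : ℝ}
    (hc : c ∈ G.formLowerBounds) {Ω : Finset V} {f : V → ℝ} (hf : ∀ x, x ∉ Ω → f x = 0)
    (hh : ∀ x, x ∉ Ω → (-G.laplacian f - c • f) x = 0) :
    G.sqNorm Ω (-G.laplacian f - c • f) ≤
      (2 * G.Dm + |c| + 1) * (G.form Ω f f - c * G.sqNorm Ω f) := by
  set h := -G.laplacian f - c • f with hdef
  set K := 2 * G.Dm + |c| + 1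
  have hK : 0 < K := by
    have := G.Dm_nonneg
    positivity
  -- With `q = form - c ‖·‖²` and `h = (-Δ - c) f`, the inequality `0 ≤ q(f - s h) = q(f) - 2s ‖h‖²
  -- + s² q(h)` together with `q(h) ≤ K ‖h‖²` yields the claim at `s = 1 / K`.
  have h1 := hc Ω (f - K⁻¹ • h) fun x hx => by
    rw [Pi.sub_apply, Pi.smul_apply, hf x hx, hh x hx, smul_zero, sub_zero]
  rw [form_sub_smul, sqNorm_sub_smul] at h1
  have h2 : G.form Ω h f - c * ∑ x ∈ Ω, h x * f x * G.m x = G.sqNorm Ω h := by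
    have := G.sum_mul_laplacian Ω h f hf
    rw [← neg_eq_iff_eq_neg] at this
    rw [← this, sqNorm, Finset.mul_sum, ← Finset.sum_neg_distrib, ← Finset.sum_sub_distrib]
    refine Finset.sum_congr rfl fun x _ => ?_
    have e : h x = -G.laplacian f x - c * f x := rfl
    linear_combination (-h x * G.m x) * e
  have h3 : G.form Ω h h - c * G.sqNorm Ω h ≤ K * G.sqNorm Ω h := by
    have := hG.form_self_le Ω h
    have h4 := mul_le_mul_of_nonneg_right (neg_abs_le c) (G.sqNorm_nonneg Ω h)
    have := G.sqNorm_nonneg Ω h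
    simp only [K]
    linarith
  have h4 : K⁻¹ ^ 2 * (G.form Ω h h - c * G.sqNorm Ω h) ≤ K⁻¹ * G.sqNorm Ω h := by
    refine (mul_le_mul_of_nonneg_left h3 (by positivity)).trans_eq ?_
    field_simp
  have h5 : K⁻¹ * G.sqNorm Ω h ≤ G.form Ω f f - c * G.sqNorm Ω f := by
    linear_combination h1 + h4 - 2 * K⁻¹ * h2
  rwa [inv_mul_le_iff₀ hK] at h5

/-- The infimum of the form of `-Δ` belongs to the spectrum. -/
theorem BoundedDegree.sSup_formLowerBounds_mem [Nonempty V] (hG : G.BoundedDegree) :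
    sSup G.formLowerBounds ∈ G.l2Spectrum := by
  classical
  rintro ⟨-, C, hC⟩
  set c := sSup G.formLowerBounds with hc_def
  have hc : c ∈ G.formLowerBounds := G.csSup_mem_formLowerBounds
  set K := 2 * G.Dm + |c| + 1
  have hK : 0 < K := by
    have := G.Dm_nonneg
    positivity
  -- A bounded inverse gives `‖f‖² ≤ C² ‖(-Δ - c) f‖² ≤ C² K q(f)`, hence a spectral gap: `c + 1 /
  -- M` would be a larger form bound. The `+ 1` only ensures `M > 0`.
  set M := C ^ 2 * K + 1
  have hM : 0 < M := by positivity
  suffices H : c + M⁻¹ ∈ G.formLowerBounds by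
    have := le_csSup G.bddAbove_formLowerBounds H
    have := inv_pos.2 hM
    linarith
  intro Ω f hf
  -- Large enough to support both `f` and `Δ f`.
  set Ω' := Ω ∪ Ω.biUnion G.nbhd
  have hsub : Ω ⊆ Ω' := Finset.subset_union_left
  have hf' : ∀ x, x ∉ Ω' → f x = 0 := fun x hx => hf x fun hx' => hx (hsub hx')
  have hl : ∀ x, x ∉ Ω' → G.laplacian f x = 0 := fun x hx =>
    G.laplacian_eq_zero hf hsub
      (fun y hy => (Finset.subset_biUnion_of_mem _ hy).trans Finset.subset_union_right) hx
  have hh : ∀ x, x ∉ Ω' → (-G.laplacian f - c • f) x = 0 := fun x hx => by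
    simp [hl x hx, hf' x hx]
  have h1 := hG.sqNorm_le_of_mem hc hf' hh
  have h2 := pow_le_pow_left₀ (Real.sqrt_nonneg _)
    (hC f ⟨G.memL2_of_support hf', G.memL2_of_support hl⟩) 2
  rw [mul_pow, G.l2norm_sq_of_support hh] at h2
  change G.l2norm f ^ 2 ≤ _ at h2
  rw [G.l2norm_sq_of_support hf'] at h2
  rw [← G.sqNorm_eq_of_subset hf hsub, ← G.form_eq_of_subset hf hsub]
  have h3 : G.sqNorm Ω' f ≤ M * (G.form Ω' f f - c * G.sqNorm Ω' f) := by
    have h4 := mul_le_mul_of_nonneg_left h1 (sq_nonneg C)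
    have h5 := hc Ω' f hf'
    simp only [M]
    linarith
  rw [← inv_mul_le_iff₀ hM] at h3
  linarith

theorem BoundedDegree.spectralBottom_mem [Nonempty V] (hG : G.BoundedDegree) :
    G.spectralBottom ∈ G.formLowerBounds := by
  by_cases h : BddBelow G.l2Spectrum
  · exact mem_formLowerBounds_of_le G.csSup_mem_formLowerBounds
      (csInf_le h hG.sSup_formLowerBounds_mem)
  -- Here the real `sInf` takes its default value `0`, which is a form bound anyway, so
  -- semiboundedness of the spectrum need not be proved.
  · rw [spectralBottom, Real.sInf_of_not_bddBelow h]
    exact G.zero_mem_formLowerBounds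

end WeightedGraph

/-! ### Conjugation by an exponential weight and the energy inequality -/

namespace WeightedGraph

variable {V : Type u} {G : WeightedGraph V}

/-- With `v = e^ψ f`, the cross term is `e^(ψ x - ψ y) v x v y`. Averaging it with its transpose
leaves `cosh (ψ x - ψ y)`, so the first-order part in `ψ` cancels. -/
theorem exp_mul_form_eq (Ω : Finset V) (f ψ : V → ℝ) :
    G.form Ω (fun x => Real.exp (2 * ψ x) * f x) f =
      G.form Ω (fun x => Real.exp (ψ x) * f x) (fun x => Real.exp (ψ x) * f x) -
        ∑ x ∈ Ω, ∑ y ∈ Ω, G.w x y * ((Real.cosh (ψ x - ψ y) - 1) *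
          ((Real.exp (ψ x) * f x) * (Real.exp (ψ y) * f y))) := by
  have e1 : ∑ x ∈ Ω, ∑ y ∈ Ω, G.w x y * (Real.exp (2 * ψ x) * f x * f y) =
      ∑ x ∈ Ω, ∑ y ∈ Ω, G.w x y * (Real.cosh (ψ x - ψ y) *
          ((Real.exp (ψ x) * f x) * (Real.exp (ψ y) * f y))) := by
    have h2 : ∀ x y, Real.cosh (ψ x - ψ y) *
        ((Real.exp (ψ x) * f x) * (Real.exp (ψ y) * f y)) =
        (1 / 2) * (Real.exp (2 * ψ x) * f x * f y) +
          (1 / 2) * (Real.exp (2 * ψ y) * f y * f x) := by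
      intro x y
      rw [Real.cosh_eq, neg_sub, Real.exp_sub, Real.exp_sub, two_mul, two_mul, Real.exp_add,
        Real.exp_add]
      field_simp
    have h3 := G.sum_sum_w_comm Ω fun x y => Real.exp (2 * ψ x) * f x * f y
    simp only [h2, mul_add, Finset.sum_add_distrib, mul_left_comm _ (1 / 2 : ℝ),
      ← Finset.mul_sum]
    linarith
  have e2 : ∑ x ∈ Ω, G.deg x * (Real.exp (2 * ψ x) * f x * f x) =
      ∑ x ∈ Ω, G.deg x * (Real.exp (ψ x) * f x * (Real.exp (ψ x) * f x)) :=
    Finset.sum_congr rfl fun x _ => by rw [two_mul, Real.exp_add]; ring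
  rw [form, form, e1, e2]
  simp only [sub_one_mul, mul_sub, Finset.sum_sub_distrib]
  ring

theorem BoundedDegree.sum_exp_mul_laplacian_le (hG : G.BoundedDegree) {c κ : ℝ}
    (hc : c ∈ G.formLowerBounds) {ψ : V → ℝ}
    (hψ : ∀ x y, 0 < G.w x y → |ψ x - ψ y| ≤ κ) {Ω : Finset V} {f : V → ℝ}
    (hf : ∀ x, x ∉ Ω → f x = 0) :
    ∑ x ∈ Ω, Real.exp (2 * ψ x) * f x * G.laplacian f x * G.m x ≤
      (G.Dm * (Real.cosh κ - 1) - c) * G.sqNorm Ω fun x => Real.exp (ψ x) * f x := by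
  rw [G.sum_mul_laplacian Ω (fun x => Real.exp (2 * ψ x) * f x) f hf, exp_mul_form_eq]
  set v := fun x => Real.exp (ψ x) * f x with hv
  have h1 := hc Ω v fun x hx => by simp [hv, hf x hx]
  have h2 : ∑ x ∈ Ω, ∑ y ∈ Ω, G.w x y * ((Real.cosh (ψ x - ψ y) - 1) * (v x * v y)) ≤
      (Real.cosh κ - 1) * ∑ x ∈ Ω, ∑ y ∈ Ω, G.w x y * (|v x| * |v y|) := by
    simp only [Finset.mul_sum]
    refine Finset.sum_le_sum fun x _ => Finset.sum_le_sum fun y _ => ?_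
    rw [mul_left_comm]
    rcases (G.w_nonneg x y).eq_or_lt with h | h
    · simp [← h]
    -- The Lipschitz bound on `ψ` is available only across edges; elsewhere the weight vanishes.
    · have h3 : Real.cosh (ψ x - ψ y) ≤ Real.cosh κ :=
        Real.cosh_le_cosh.2 ((hψ x y h).trans (le_abs_self κ))
      have h4 := Real.one_le_cosh (ψ x - ψ y)
      calc (Real.cosh (ψ x - ψ y) - 1) * (G.w x y * (v x * v y))
          ≤ (Real.cosh (ψ x - ψ y) - 1) * (G.w x y * (|v x| * |v y|)) := by
            rw [← abs_mul]
            have := sub_nonneg.2 h4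
            gcongr
            exact le_abs_self _
        _ ≤ _ := by gcongr
  have h5 := mul_le_mul_of_nonneg_left ((G.sum_sum_w_abs_le Ω v).trans (hG.sum_deg_le Ω v))
    (sub_nonneg.2 (Real.one_le_cosh κ))
  linarith

/-- Grönwall's inequality: `F s e^(-a s)` is nonincreasing. -/
theorem le_mul_exp_of_deriv_le {F F' : ℝ → ℝ} {a t : ℝ}
    (hF : ∀ s, HasDerivAt F (F' s) s) (hle : ∀ s, F' s ≤ a * F s) (ht : 0 ≤ t) :
    F t ≤ F 0 * Real.exp (a * t) := by
  have hd : ∀ s, HasDerivAt (fun s => F s * Real.exp (-(a * s)))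
      (F' s * Real.exp (-(a * s)) + F s * (Real.exp (-(a * s)) * -(a * 1))) s := fun s =>
    (hF s).mul ((((hasDerivAt_id s).const_mul a).neg).exp)
  have hanti : Antitone fun s => F s * Real.exp (-(a * s)) := by
    refine antitone_of_deriv_nonpos (fun s => (hd s).differentiableAt) fun s => ?_
    rw [(hd s).deriv]
    have := mul_le_mul_of_nonneg_right (hle s) (Real.exp_pos (-(a * s))).le
    linarith
  have := hanti ht
  simp only [mul_zero, neg_zero, Real.exp_zero, mul_one, Real.exp_neg] at this
  rwa [mul_inv_le_iff₀ (Real.exp_pos _)] at this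

/-! ### Weighted estimates for the Dirichlet heat flow -/

variable (G) in
/-- The solution of the Dirichlet heat equation on `Ω` with initial value the indicator of `S`. -/
noncomputable def dirichletHeat (Ω S : Finset V) (t : ℝ) (x : V) : ℝ :=
  ∑ y ∈ S, G.dirichletHeatKernel Ω t x y * G.m y

theorem laplacian_dirichletHeat (Ω S : Finset V) (t : ℝ) (x : V) :
    G.laplacian (G.dirichletHeat Ω S t) x =
      ∑ y ∈ S, G.laplacian (fun z => G.dirichletHeatKernel Ω t z y) x * G.m y := by
  simp only [laplacian, dirichletHeat, mul_assoc, ← Finset.mul_sum, Finset.sum_mul]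
  rw [Finset.sum_comm]
  congr 1
  refine Finset.sum_congr rfl fun z _ => ?_
  rw [← Finset.mul_sum, ← Finset.sum_sub_distrib]
  congr 1
  exact Finset.sum_congr rfl fun y _ => by ring

theorem hasDerivAt_dirichletHeat (Ω S : Finset V) (t : ℝ) (x : V) (hx : x ∈ Ω) :
    HasDerivAt (fun s => G.dirichletHeat Ω S s x) (G.laplacian (G.dirichletHeat Ω S t) x) t := by
  rw [laplacian_dirichletHeat]
  exact HasDerivAt.fun_sum fun y _ =>
    (G.hasDerivAt_dirichletHeatKernel Ω t x y hx).mul_const (G.m y)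

theorem dirichletHeat_eq_zero (Ω S : Finset V) (t : ℝ) (x : V) (hx : x ∉ Ω) :
    G.dirichletHeat Ω S t x = 0 :=
  Finset.sum_eq_zero fun y _ => by rw [G.dirichletHeatKernel_of_notMem Ω t x y hx, zero_mul]

open scoped Classical in
theorem dirichletHeat_zero {Ω S : Finset V} (h : S ⊆ Ω) (x : V) :
    G.dirichletHeat Ω S 0 x = if x ∈ S then 1 else 0 := by
  rw [dirichletHeat, ← Finset.sum_ite_eq S x fun _ => (1 : ℝ)]
  refine Finset.sum_congr rfl fun y hy => ?_
  rw [G.dirichletHeatKernel_zero Ω x y (h hy), div_mul_cancel₀ _ (G.m_pos y).ne',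
    Pi.single_apply]

/-- Davies' weighted `ℓ²`-estimate. -/
theorem BoundedDegree.sqNorm_exp_mul_dirichletHeat_le (hG : G.BoundedDegree) {c κ : ℝ}
    (hc : c ∈ G.formLowerBounds) {ψ : V → ℝ}
    (hψ : ∀ x y, 0 < G.w x y → |ψ x - ψ y| ≤ κ) {Ω S : Finset V} (hS : S ⊆ Ω)
    (hψS : ∀ x ∈ S, ψ x = 0) {t : ℝ} (ht : 0 ≤ t) :
    (G.sqNorm Ω fun x => Real.exp (ψ x) * G.dirichletHeat Ω S t x) ≤
      (∑ x ∈ S, G.m x) * Real.exp (2 * (G.Dm * (Real.cosh κ - 1) - c) * t) := by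
  classical
  have h0 : (G.sqNorm Ω fun x => Real.exp (ψ x) * G.dirichletHeat Ω S 0 x) =
      ∑ x ∈ S, G.m x := by
    rw [sqNorm, ← Finset.sum_subset hS]
    · exact Finset.sum_congr rfl fun x hx => by simp [dirichletHeat_zero hS, hψS x hx, hx]
    · intro x _ hx
      simp [dirichletHeat_zero hS, hx]
  rw [← h0]
  refine le_mul_exp_of_deriv_le
    (F := fun s => G.sqNorm Ω fun x => Real.exp (ψ x) * G.dirichletHeat Ω S s x)
    (F' := fun s => 2 * ∑ x ∈ Ω, Real.exp (2 * ψ x) * G.dirichletHeat Ω S s x *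
      G.laplacian (G.dirichletHeat Ω S s) x * G.m x) (fun s => ?_) (fun s => ?_) ht
  · have : ∀ x ∈ Ω, HasDerivAt
        (fun s => (Real.exp (ψ x) * G.dirichletHeat Ω S s x) ^ 2 * G.m x)
        (2 * (Real.exp (2 * ψ x) * G.dirichletHeat Ω S s x *
          G.laplacian (G.dirichletHeat Ω S s) x * G.m x)) s := fun x hx => by
      refine ((((hasDerivAt_dirichletHeat Ω S s x hx).const_mul
        (Real.exp (ψ x))).fun_pow 2).mul_const (G.m x)).congr_deriv ?_
      rw [two_mul (ψ x), Real.exp_add]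
      ring
    rw [Finset.mul_sum]
    exact HasDerivAt.fun_sum this
  · rw [mul_assoc 2]
    exact mul_le_mul_of_nonneg_left (hG.sum_exp_mul_laplacian_le hc hψ
      fun x hx => dirichletHeat_eq_zero Ω S s x hx) zero_le_two

theorem BoundedDegree.sum_dirichletHeat_le (hG : G.BoundedDegree) {c κ : ℝ}
    (hc : c ∈ G.formLowerBounds) {ψ : V → ℝ}
    (hψ : ∀ x y, 0 < G.w x y → |ψ x - ψ y| ≤ κ) {Ω S T : Finset V} (hS : S ⊆ Ω) (hT : T ⊆ Ω)
    (hψS : ∀ x ∈ S, ψ x = 0) {r : ℝ} (hψT : ∀ x ∈ T, r ≤ ψ x) {t : ℝ} (ht : 0 ≤ t) :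
    ∑ x ∈ T, G.dirichletHeat Ω S t x * G.m x ≤
      √((∑ x ∈ T, G.m x) * ∑ x ∈ S, G.m x) *
        Real.exp ((G.Dm * (Real.cosh κ - 1) - c) * t - r) := by
  have h1 := hG.sqNorm_exp_mul_dirichletHeat_le hc hψ hS hψS ht
  -- Cauchy–Schwarz for `u = e^(-ψ) · e^ψ u`: the first factor supplies the decay `e^(-r)` on `T`,
  -- the second is the weighted norm already controlled.
  have h2 : (∑ x ∈ T, G.dirichletHeat Ω S t x * G.m x) ^ 2 ≤
      (∑ x ∈ T, Real.exp (-(2 * ψ x)) * G.m x) *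
        ∑ x ∈ T, (Real.exp (ψ x) * G.dirichletHeat Ω S t x) ^ 2 * G.m x := by
    refine Finset.sum_sq_le_sum_mul_sum_of_sq_le_mul T (fun x _ => ?_) (fun x _ => ?_)
      fun x _ => ?_
    · exact mul_nonneg (Real.exp_pos _).le (G.m_pos x).le
    · exact mul_nonneg (sq_nonneg _) (G.m_pos x).le
    · have : Real.exp (-(2 * ψ x)) * Real.exp (ψ x) ^ 2 = 1 := by
        rw [← Real.exp_nat_mul, ← Real.exp_add]
        simp
      refine le_of_eq ?_
      linear_combination -(G.dirichletHeat Ω S t x * G.m x) ^ 2 * this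
  have h3 : ∑ x ∈ T, Real.exp (-(2 * ψ x)) * G.m x ≤ Real.exp (-(2 * r)) * ∑ x ∈ T, G.m x := by
    rw [Finset.mul_sum]
    refine Finset.sum_le_sum fun x hx => mul_le_mul_of_nonneg_right ?_ (G.m_pos x).le
    exact Real.exp_le_exp.2 (by linarith [hψT x hx])
  have h4 : ∑ x ∈ T, (Real.exp (ψ x) * G.dirichletHeat Ω S t x) ^ 2 * G.m x ≤
      G.sqNorm Ω fun x => Real.exp (ψ x) * G.dirichletHeat Ω S t x :=
    Finset.sum_le_sum_of_subset_of_nonneg hT fun x _ _ =>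
      mul_nonneg (sq_nonneg _) (G.m_pos x).le
  have hT0 : 0 ≤ ∑ x ∈ T, G.m x := Finset.sum_nonneg fun x _ => (G.m_pos x).le
  have hS0 : 0 ≤ ∑ x ∈ S, G.m x := Finset.sum_nonneg fun x _ => (G.m_pos x).le
  refine le_of_abs_le (abs_le_of_sq_le_sq ?_ (by positivity))
  rw [mul_pow, Real.sq_sqrt (mul_nonneg hT0 hS0), ← Real.exp_nat_mul]
  refine h2.trans ((mul_le_mul h3 (h4.trans h1) (Finset.sum_nonneg fun x _ =>
    mul_nonneg (sq_nonneg _) (G.m_pos x).le) (by positivity)).trans_eq ?_)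
  rw [show ((2 : ℕ) : ℝ) * ((G.Dm * (Real.cosh κ - 1) - c) * t - r) =
    -(2 * r) + 2 * (G.Dm * (Real.cosh κ - 1) - c) * t by push_cast; ring, Real.exp_add]
  ring

/-- The Dirichlet bound does not depend on `Ω`, so it survives the limit. Since each `Ω` is finite,
`ψ` may be unbounded and needs no truncation. -/
theorem BoundedDegree.sum_minimalHeatKernel_le (hG : G.BoundedDegree) {c κ : ℝ}
    (hc : c ∈ G.formLowerBounds) {ψ : V → ℝ}
    (hψ : ∀ x y, 0 < G.w x y → |ψ x - ψ y| ≤ κ) {S T : Finset V}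
    (hψS : ∀ x ∈ S, ψ x = 0) {r : ℝ} (hψT : ∀ x ∈ T, r ≤ ψ x) {t : ℝ} (ht : 0 ≤ t) :
    ∑ x ∈ T, ∑ y ∈ S, G.minimalHeatKernel t x y * G.m x * G.m y ≤
      √((∑ x ∈ T, G.m x) * ∑ x ∈ S, G.m x) *
        Real.exp ((G.Dm * (Real.cosh κ - 1) - c) * t - r) := by
  classical
  refine le_of_tendsto (tendsto_finsetSum T fun x _ => tendsto_finsetSum S fun y _ =>
    ((G.tendsto_minimalHeatKernel t ht x y).mul_const (G.m x)).mul_const (G.m y)) ?_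
  filter_upwards [Filter.eventually_ge_atTop (S ∪ T)] with Ω hΩ
  refine le_of_eq_of_le ?_ (hG.sum_dirichletHeat_le hc hψ (Finset.subset_union_left.trans hΩ)
    (Finset.subset_union_right.trans hΩ) hψS hψT ht)
  refine Finset.sum_congr rfl fun x _ => ?_
  rw [dirichletHeat, Finset.sum_mul]
  exact Finset.sum_congr rfl fun y _ => by ring

/-! ### The distance to a set as weight function -/

variable (G) in
theorem abs_setDist_sub_le {B : Set V} (hB : B.Nonempty) {x y : V} (h : 0 < G.w x y) :
    |(G.setDist {x} B : ℝ) - G.setDist {y} B| ≤ 1 := by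
  have key : ∀ x y, 0 < G.w x y → G.setDist {x} B ≤ G.setDist {y} B + 1 := by
    intro x y h
    obtain ⟨b, hb⟩ := hB
    -- The distance from `y` to the nonempty set `B` is attained at some `z`; the triangle
    -- inequality through `z` then suffices.
    obtain ⟨y', rfl, z, hz, e⟩ := Nat.sInf_mem
      (s := {n | ∃ y' ∈ ({y} : Set V), ∃ z ∈ B, G.graph.dist y' z = n}) ⟨_, y, rfl, b, hb, rfl⟩
    have h1 : G.setDist {x} B ≤ G.graph.dist x z := Nat.sInf_le ⟨x, rfl, z, hz, rfl⟩
    have h2 : G.graph.dist x z ≤ G.graph.dist x y' + G.graph.dist y' z :=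
      G.connected.dist_triangle
    have h3 : G.graph.dist x y' ≤ 1 := by
      by_cases hxy : x = y'
      · simp [hxy]
      · refine (SimpleGraph.dist_eq_one_iff_adj.2 ?_).le
        exact (SimpleGraph.fromRel_adj _ _ _).2 ⟨hxy, Or.inl h⟩
    change _ = G.setDist {y'} B at e
    omega
  have h1 := key x y h
  have h2 := key y x (G.w_symm x y ▸ h)
  rw [abs_le]
  constructor
  · have : (G.setDist {y} B : ℝ) ≤ G.setDist {x} B + 1 := by exact_mod_cast h2
    linarith
  · have : (G.setDist {x} B : ℝ) ≤ G.setDist {y} B + 1 := by exact_mod_cast h1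
    linarith

variable (G) in
theorem setDist_le_setDist_singleton {B₁ B₂ : Set V} (h₂ : B₂.Nonempty) {x : V} (hx : x ∈ B₁) :
    G.setDist B₁ B₂ ≤ G.setDist {x} B₂ := by
  obtain ⟨b, hb⟩ := h₂
  obtain ⟨x', rfl, z, hz, e⟩ := Nat.sInf_mem
    (s := {n | ∃ x' ∈ ({x} : Set V), ∃ z ∈ B₂, G.graph.dist x' z = n}) ⟨_, x, rfl, b, hb, rfl⟩
  exact Nat.sInf_le ⟨x', hx, z, hz, e⟩

variable (G) in
theorem setDist_singleton_of_mem {B : Set V} {x : V} (hx : x ∈ B) : G.setDist {x} B = 0 :=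
  Nat.sInf_eq_zero.2 (Or.inl ⟨x, rfl, x, hx, SimpleGraph.dist_self⟩)

/-- Davies' bound with a free parameter `κ`, for finite sets. -/
theorem BoundedDegree.sum_minimalHeatKernel_le_exp_setDist (hG : G.BoundedDegree) {c κ : ℝ}
    (hc : c ∈ G.formLowerBounds) (hκ : 0 ≤ κ) {B₁ B₂ : Set V} {T S : Finset V}
    (hT : ∀ x ∈ T, x ∈ B₁) (hS : ∀ x ∈ S, x ∈ B₂) {t : ℝ} (ht : 0 ≤ t) :
    ∑ x ∈ T, ∑ y ∈ S, G.minimalHeatKernel t x y * G.m x * G.m y ≤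
      √((∑ x ∈ T, G.m x) * ∑ x ∈ S, G.m x) *
        Real.exp ((G.Dm * (Real.cosh κ - 1) - c) * t - κ * G.setDist B₁ B₂) := by
  -- The distance lemmas need a point of `B₂`; for empty `B₂` the sum over `S` is empty.
  rcases B₂.eq_empty_or_nonempty with rfl | h₂
  · rw [Finset.eq_empty_of_forall_notMem hS]
    simp
  refine hG.sum_minimalHeatKernel_le hc (ψ := fun x => κ * G.setDist {x} B₂)
    (fun x y h => ?_) (fun x hx => ?_) (fun x hx => ?_) ht
  · rw [← mul_sub, abs_mul, abs_of_nonneg hκ]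
    exact mul_le_of_le_one_right hκ (G.abs_setDist_sub_le h₂ h)
  · simp [G.setDist_singleton_of_mem (hS x hx)]
  · exact mul_le_mul_of_nonneg_left
      (by exact_mod_cast G.setDist_le_setDist_singleton h₂ (hT x hx)) hκ

/-! ### From finite sets to arbitrary sets -/

theorem sum_image_le_vol [DecidableEq V] {B : Set V} (s : Finset B) :
    ENNReal.ofReal (∑ x ∈ s.image Subtype.val, G.m x) ≤ G.vol B := by
  rw [ENNReal.ofReal_sum_of_nonneg fun x _ => (G.m_pos x).le,
    Finset.sum_image fun a _ b _ h => Subtype.ext h]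
  exact ENNReal.sum_le_tsum s

theorem tsum_minimalHeatKernel_le {B₁ B₂ : Set V} {t : ℝ} (ht : 0 ≤ t) {a : ℝ} (ha : 0 ≤ a)
    (h : ∀ T S : Finset V, (∀ x ∈ T, x ∈ B₁) → (∀ x ∈ S, x ∈ B₂) →
      ∑ x ∈ T, ∑ y ∈ S, G.minimalHeatKernel t x y * G.m x * G.m y ≤
        √((∑ x ∈ T, G.m x) * ∑ x ∈ S, G.m x) * a) :
    ∑' x : B₁, ∑' y : B₂, ENNReal.ofReal (G.minimalHeatKernel t x y * G.m x * G.m y) ≤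
      (G.vol B₁ * G.vol B₂) ^ (1 / 2 : ℝ) * ENNReal.ofReal a := by
  classical
  have hp : ∀ x y, 0 ≤ G.minimalHeatKernel t x y * G.m x * G.m y := fun x y =>
    mul_nonneg (mul_nonneg (ge_of_tendsto' (G.tendsto_minimalHeatKernel t ht x y)
      fun Ω => G.dirichletHeatKernel_nonneg Ω t ht x y) (G.m_pos x).le) (G.m_pos y).le
  rw [← ENNReal.tsum_prod, ENNReal.tsum_eq_iSup_sum]
  refine iSup_le fun s => ?_
  -- A finite set of pairs is enlarged to the product of its projections, where the finite estimate
  -- applies; nonnegativity of the kernel makes this harmless.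
  set s₁ := s.image Prod.fst
  set s₂ := s.image Prod.snd
  set T := s₁.image Subtype.val
  set S := s₂.image Subtype.val
  have h1 := h T S (fun x hx => by obtain ⟨y, -, rfl⟩ := Finset.mem_image.1 hx; exact y.2)
    (fun x hx => by obtain ⟨y, -, rfl⟩ := Finset.mem_image.1 hx; exact y.2)
  have hT : 0 ≤ ∑ x ∈ T, G.m x := Finset.sum_nonneg fun x _ => (G.m_pos x).le
  have hS : 0 ≤ ∑ x ∈ S, G.m x := Finset.sum_nonneg fun x _ => (G.m_pos x).le
  calc ∑ p ∈ s, ENNReal.ofReal (G.minimalHeatKernel t p.1 p.2 * G.m p.1 * G.m p.2)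
      ≤ ∑ p ∈ s₁ ×ˢ s₂, ENNReal.ofReal (G.minimalHeatKernel t p.1 p.2 * G.m p.1 * G.m p.2) :=
        Finset.sum_le_sum_of_subset Finset.subset_product
    _ = ENNReal.ofReal (∑ x ∈ T, ∑ y ∈ S, G.minimalHeatKernel t x y * G.m x * G.m y) := by
        rw [Finset.sum_product, Finset.sum_image fun a _ b _ h => Subtype.ext h,
          ENNReal.ofReal_sum_of_nonneg fun x _ => Finset.sum_nonneg fun y _ => hp _ _]
        refine Finset.sum_congr rfl fun x _ => ?_
        rw [Finset.sum_image fun a _ b _ h => Subtype.ext h,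
          ENNReal.ofReal_sum_of_nonneg fun y _ => hp _ _]
    _ ≤ ENNReal.ofReal (√((∑ x ∈ T, G.m x) * ∑ x ∈ S, G.m x) * a) :=
        ENNReal.ofReal_le_ofReal h1
    _ ≤ _ := by
        rw [ENNReal.ofReal_mul' ha, Real.sqrt_eq_rpow,
          ← ENNReal.ofReal_rpow_of_nonneg (mul_nonneg hT hS) (by norm_num), ENNReal.ofReal_mul hT]
        gcongr
        · exact G.sum_image_le_vol s₁
        · exact G.sum_image_le_vol s₂

/-- The Davies–Gaffney–Grigor'yan estimate with a free parameter `κ`. -/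
theorem BoundedDegree.tsum_minimalHeatKernel_le (hG : G.BoundedDegree) {c κ b : ℝ}
    (hc : c ∈ G.formLowerBounds) (hκ : 0 ≤ κ) (B₁ B₂ : Set V) {t : ℝ} (ht : 0 ≤ t)
    (hb : (G.Dm * (Real.cosh κ - 1) - c) * t - κ * G.setDist B₁ B₂ ≤ b) :
    ∑' x : B₁, ∑' y : B₂, ENNReal.ofReal (G.minimalHeatKernel t x y * G.m x * G.m y) ≤
      (G.vol B₁ * G.vol B₂) ^ (1 / 2 : ℝ) * ENNReal.ofReal (Real.exp b) :=
  WeightedGraph.tsum_minimalHeatKernel_le ht (Real.exp_pos _).le fun _ _ hT hS =>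
    (hG.sum_minimalHeatKernel_le_exp_setDist hc hκ hT hS ht).trans
      (mul_le_mul_of_nonneg_left (Real.exp_le_exp.2 hb) (Real.sqrt_nonneg _))

/-- At `D_m t = 0` no heat has moved between sets at positive distance. -/
theorem BoundedDegree.tsum_minimalHeatKernel_eq_zero (hG : G.BoundedDegree) (B₁ B₂ : Set V)
    {t : ℝ} (ht : 0 ≤ t) (hDt : G.Dm * t = 0) (hd : 0 < G.setDist B₁ B₂) :
    ∑' x : B₁, ∑' y : B₂, ENNReal.ofReal (G.minimalHeatKernel t x y * G.m x * G.m y) = 0 := by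
  refine le_antisymm ((WeightedGraph.tsum_minimalHeatKernel_le ht le_rfl
    fun T S hT hS => ?_).trans (by simp)) zero_le
  -- With `D_m t = 0` the cost `D_m t (cosh κ - 1)` vanishes for every `κ`, so `κ → ∞` forces each
  -- finite sum to be at most `0`.
  have hlim : Filter.Tendsto (fun κ : ℝ => √((∑ x ∈ T, G.m x) * ∑ x ∈ S, G.m x) *
      Real.exp (-(κ * G.setDist B₁ B₂))) Filter.atTop
        (𝓝 (√((∑ x ∈ T, G.m x) * ∑ x ∈ S, G.m x) * 0)) :=
    (Real.tendsto_exp_neg_atTop_nhds_zero.comp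
      (Filter.tendsto_id.atTop_mul_const (by exact_mod_cast hd))).const_mul _
  refine ge_of_tendsto hlim ?_
  filter_upwards [Filter.eventually_ge_atTop 0] with κ hκ
  refine (hG.sum_minimalHeatKernel_le_exp_setDist G.zero_mem_formLowerBounds hκ hT hS
    ht).trans_eq ?_
  congr 2
  linear_combination (Real.cosh κ - 1) * hDt

end WeightedGraph

/-! ### Choice of `κ` and conclusion -/

/-- `ζ` is the Legendre transform of `κ ↦ s (cosh κ - 1)`: the maximizer of `κ d - s (cosh κ - 1)`
is `κ = arsinh (d / s)`, and `cosh κ = √(1 + (d / s)²)` there. -/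
theorem zeta_eq_sub_cosh {s : ℝ} (hs : 0 < s) (d : ℝ) :
    zeta s d = ((Real.arsinh (d / s) * d - s * (Real.cosh (Real.arsinh (d / s)) - 1) : ℝ) :
      EReal) := by
  have h : √(d ^ 2 + s ^ 2) = s * √(1 + (d / s) ^ 2) := by
    rw [show d ^ 2 + s ^ 2 = s ^ 2 * (1 + (d / s) ^ 2) by field_simp; ring,
      Real.sqrt_mul (sq_nonneg s), Real.sqrt_sq hs.le]
  rw [zeta, if_neg fun h => hs.ne' h.1, Real.cosh_arsinh, h]
  congr 1
  ring

theorem mainTheorem1 :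
    (∀ γ : ℝ, 0 < γ → γ < 1 → ∃ α : ℝ, 1 ≤ α ∧
      ∀ (V : Type u) [Infinite V] (G : WeightedGraph V), G.BoundedDegree →
      ∀ (B₁ B₂ : Set V) (t : ℝ), 0 ≤ t →
        ∑' x : B₁, ∑' y : B₂, ENNReal.ofReal (G.minimalHeatKernel t x y * G.m x * G.m y) ≤
          (G.vol B₁ * G.vol B₂) ^ (1 / 2 : ℝ) *
            ENNReal.ofReal (Real.exp (-((1 - γ) * G.spectralBottom * t))) *
            EReal.exp (-zeta (α * G.Dm * t + 1) (G.setDist B₁ B₂))) ∧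
    (∀ (V : Type u) [Infinite V] (G : WeightedGraph V), G.BoundedDegree →
      ∀ (B₁ B₂ : Set V) (t : ℝ), 0 ≤ t →
        ∑' x : B₁, ∑' y : B₂, ENNReal.ofReal (G.minimalHeatKernel t x y * G.m x * G.m y) ≤
          (G.vol B₁ * G.vol B₂) ^ (1 / 2 : ℝ) *
            EReal.exp (-(((1 / 2 : ℝ) : EReal) * zeta (G.Dm * t) (G.setDist B₁ B₂)))) := by
  constructor
  · refine fun γ hγ hγ1 => ⟨1, le_rfl, fun V _ G hG B₁ B₂ t ht => ?_⟩
    have hD := mul_nonneg G.Dm_nonneg ht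
    have hs : 0 < 1 * G.Dm * t + 1 := by linarith
    rw [zeta_eq_sub_cosh hs, ← EReal.coe_neg, EReal.exp_coe, mul_assoc,
      ← ENNReal.ofReal_mul (Real.exp_pos _).le, ← Real.exp_add]
    set κ := Real.arsinh (G.setDist B₁ B₂ / (1 * G.Dm * t + 1))
    have hκ : 0 ≤ κ := Real.arsinh_nonneg_iff.2 (by positivity)
    have h1 := Real.one_le_cosh κ
    -- The sign of the spectral bottom is not needed: a nonpositive one is replaced by the form
    -- bound `0`. The `+ 1` in the time argument costs only the nonnegative term `cosh κ - 1`, and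
    -- in the first case `γ μ t` is further slack.
    rcases le_total 0 G.spectralBottom with h | h
    · refine hG.tsum_minimalHeatKernel_le hG.spectralBottom_mem hκ B₁ B₂ ht ?_
      have := mul_nonneg (mul_nonneg hγ.le h) ht
      linarith
    · refine hG.tsum_minimalHeatKernel_le G.zero_mem_formLowerBounds hκ B₁ B₂ ht ?_
      have := mul_nonneg (mul_nonneg (sub_nonneg.2 hγ1.le) (neg_nonneg.2 h)) ht
      linarith
  · intro V _ G hG B₁ B₂ t ht
    rcases (mul_nonneg G.Dm_nonneg ht).eq_or_lt with hDt | hDt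
    · rcases (G.setDist B₁ B₂).eq_zero_or_pos with hd | hd
      · have h0 : zeta (G.Dm * t) (G.setDist B₁ B₂) = 0 := by simp [zeta, ← hDt, hd]
        have := hG.tsum_minimalHeatKernel_le G.zero_mem_formLowerBounds le_rfl B₁ B₂ ht
          (b := 0) (by simp)
        simpa [h0] using this
      · rw [hG.tsum_minimalHeatKernel_eq_zero B₁ B₂ ht hDt.symm hd]
        exact zero_le
    · rw [zeta_eq_sub_cosh hDt, ← EReal.coe_mul, ← EReal.coe_neg, EReal.exp_coe]
      set κ := Real.arsinh (G.setDist B₁ B₂ / (G.Dm * t))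
      set z := κ * G.setDist B₁ B₂ - G.Dm * t * (Real.cosh κ - 1) with hz
      -- For `z ≥ 0` the optimal `κ` gives `e^(-z)`, stronger than `e^(-z / 2)`. For `z ≤ 0` the
      -- choice `κ = 0` already suffices, so the sign of `ζ` need not be determined.
      rcases le_total 0 z with h | h
      · refine hG.tsum_minimalHeatKernel_le G.zero_mem_formLowerBounds
          (Real.arsinh_nonneg_iff.2 (by positivity)) B₁ B₂ ht (κ := κ) ?_
        linarith
      · refine hG.tsum_minimalHeatKernel_le G.zero_mem_formLowerBounds le_rfl B₁ B₂ ht ?_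
        simpa using mul_nonpos_of_nonneg_of_nonpos (by norm_num : (0 : ℝ) ≤ 2⁻¹) h
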